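/- Conventions. An \emph{interior algebra} is a Boolean algebra $B$ with a map $g\colon B\to B$ satisfying $g(1)=1$, $g(a\cdot b)=g(a)\cdot g(b)$, $g(a)\le a$ and $g(g(a))=g(a)$; homomorphisms are Boolean homomorphisms commuting with $g$. For a Heyting algebra $L$ let $\mathrm{Fr}(L)$ be its free Boolean extension, i.e. the Boolean subalgebra of the power set of the set of prime ideals of $L$ generated by the image of the Stone embedding; $L$ is regarded as a bounded sublattice of $\mathrm{Fr}(L)$. Let $\mathcal B(L)=\langle \mathrm{Fr}(L),g_L\rangle$ be the interior algebra with $$g_L\big((-u_1+v_1)\cdots(-u_n+v_n)\big)=(u_1\Rightarrow v_1)\cdots(u_n\Rightarrow v_n)\qquad(u_i,v_i\in L),$$ and for a homomorphism $h\colon L\to M$ of Heyting algebras let $\mathcal B(h)\colon\mathcal B(L)\to\mathcal B(M)$ be the unique homomorphism of interior algebras extending $h$. For a variety $\mathbf V$ of Heyting algebras let $\rho^*(\mathbf V)$ be the variety of interior algebras generated by $\{\mathcal B(L): L\in\mathbf V\}$. For a variety $\mathbf W$ (of Heyting algebras or of interior algebras), $A\in\mathbf W$ is \emph{finitely presented in}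 $\mathbf W$ if it is presented, relative to $\mathbf W$, by finitely many generators and finitely many relations; $A\in\mathbf W$ is \emph{projective in} $\mathbf W$ if every homomorphism $A\to C$ lifts along every surjective homomorphism $D\to C$ with $C,D\in\mathbf W$. If $A$ is finitely presented in $\mathbf W$, a \emph{unifier} of $A$ in $\mathbf W$ is a pair $\langle u,P\rangle$ where $P\in\mathbf W$ is finitely presented and projective in $\mathbf W$ and $u\colon A\to P$ is a homomorphism. Theorem. Let $\mathbf V$ be a variety of Heyting algebras. If $L$ is finitely presented in $\mathbf V$ and $\langle u,M\rangle$ is a unifier of $L$ in $\mathbf V$, then $\mathcal B(L)$ is finitely presented in $\rho^*(\mathbf V)$ and $\langle\mathcal B(u),\mathcal B(M)\rangle$ is a unifier of $\mathcal B(L)$ in $\rho^*(\mathbf V)$. In particular, if $M$ is finitely presented and projective in $\mathbf V$, then $\mathcal B(M)$ is finitely presented and projective in $\rho^*(\mathbf V)$. -/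

import Mathlib

universe u v

/-! ### Interior algebras -/

/-- An interior algebra `⟨B, g⟩`: a Boolean algebra with an interior operator `g`. -/
class InteriorAlgebra (B : Type u) extends BooleanAlgebra B where
  g : B → B
  g_top : g ⊤ = ⊤
  g_inf : ∀ a b, g (a ⊓ b) = g a ⊓ g b
  g_le : ∀ a, g a ≤ a
  g_idem : ∀ a, g (g a) = g a

/-- Homomorphisms of interior algebras: Boolean homomorphisms that commute with `g`. -/
structure InteriorHom (A : Type u) (B : Type v) [InteriorAlgebra A] [InteriorAlgebra B] extends
    BoundedLatticeHom A B where
  map_g' : ∀ a, toFun (InteriorAlgebra.g a) = InteriorAlgebra.g (toFun a)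

instance InteriorHom.instFunLike (A : Type u) (B : Type v) [InteriorAlgebra A]
    [InteriorAlgebra B] : FunLike (InteriorHom A B) A B where
  coe f := f.toFun
  coe_injective f f' h := by
    obtain ⟨f, _⟩ := f
    obtain ⟨f', _⟩ := f'
    have : f = f' := DFunLike.coe_injective h
    subst this
    rfl

/-! ### Terms, identities, varieties: Heyting algebras -/

/-- Terms in the language of Heyting algebras over a set `X` of variables. -/
inductive HeytTerm (X : Type) : Type
  | var : X → HeytTerm X
  | bot : HeytTerm X
  | top : HeytTerm X
  | inf : HeytTerm X → HeytTerm X → HeytTerm X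
  | sup : HeytTerm X → HeytTerm X → HeytTerm X
  | imp : HeytTerm X → HeytTerm X → HeytTerm X

/-- The value of a term under an assignment `a` of the variables. -/
def HeytTerm.eval {X : Type} {A : Type u} [HeytingAlgebra A] (a : X → A) : HeytTerm X → A
  | var x => a x
  | bot => ⊥
  | top => ⊤
  | inf s t => s.eval a ⊓ t.eval a
  | sup s t => s.eval a ⊔ t.eval a
  | imp s t => s.eval a ⇨ t.eval a

/-- Classes of Heyting algebras. -/
abbrev HeytClass : Type (u + 1) := ∀ (A : Type u) [HeytingAlgebra A], Prop

namespace HeytClass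

/-- A variety is an equational class: the class of all models of some set of identities. -/
def IsVariety (V : HeytClass.{u}) : Prop :=
  ∃ E : Set (HeytTerm ℕ × HeytTerm ℕ), ∀ (A : Type u) [HeytingAlgebra A],
    V A ↔ ∀ e ∈ E, ∀ a : ℕ → A, e.1.eval a = e.2.eval a

/-- `M` is finitely presented in `V`: it belongs to `V` and is presented in `V` by
finitely many generators and finitely many relations. -/
def IsFinitelyPresented (V : HeytClass.{u}) (M : Type u) [HeytingAlgebra M] : Prop :=
  V M ∧ ∃ (n : ℕ) (R : Set (HeytTerm (Fin n) × HeytTerm (Fin n))) (a : Fin n → M),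
    R.Finite ∧ (∀ r ∈ R, r.1.eval a = r.2.eval a) ∧
      ∀ (B : Type u) [HeytingAlgebra B], V B → ∀ b : Fin n → B,
        (∀ r ∈ R, r.1.eval b = r.2.eval b) → ∃! h : HeytingHom M B, ∀ i, h (a i) = b i

/-- `M` is projective in `V`: it belongs to `V` and homomorphisms out of `M` lift along
surjective homomorphisms of `V`. -/
def IsProjective (V : HeytClass.{u}) (M : Type u) [HeytingAlgebra M] : Prop :=
  V M ∧ ∀ (A C : Type u) [HeytingAlgebra A] [HeytingAlgebra C], V A → V C →
    ∀ f : HeytingHom A C, Function.Surjective f → ∀ h : HeytingHom M C,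
      ∃ k : HeytingHom M A, ∀ x, f (k x) = h x

/-- The pair `⟨u, M⟩`, where `u : L → M` is a homomorphism, is a unifier in `V` of the algebra
`L`, finitely presented in `V`. -/
structure IsUnifier (V : HeytClass.{u}) {L M : Type u} [HeytingAlgebra L] [HeytingAlgebra M]
    (u : HeytingHom L M) : Prop where
  source_finitelyPresented : IsFinitelyPresented V L
  target_finitelyPresented : IsFinitelyPresented V M
  target_projective : IsProjective V M

end HeytClass

/-! ### Terms, identities, varieties: interior algebras -/

/-- Terms in the language of interior algebras over a set `X` of variables. -/
inductive IntTerm (X : Type) : Type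
  | var : X → IntTerm X
  | bot : IntTerm X
  | top : IntTerm X
  | inf : IntTerm X → IntTerm X → IntTerm X
  | sup : IntTerm X → IntTerm X → IntTerm X
  | compl : IntTerm X → IntTerm X
  | g : IntTerm X → IntTerm X

/-- The value of a term under an assignment `a` of the variables. -/
def IntTerm.eval {X : Type} {A : Type u} [InteriorAlgebra A] (a : X → A) : IntTerm X → A
  | var x => a x
  | bot => ⊥
  | top => ⊤
  | inf s t => s.eval a ⊓ t.eval a
  | sup s t => s.eval a ⊔ t.eval a
  | compl s => (s.eval a)ᶜ
  | g s => InteriorAlgebra.g (s.eval a)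

/-- Classes of interior algebras. -/
abbrev IntClass : Type (u + 1) := ∀ (A : Type u) [InteriorAlgebra A], Prop

namespace IntClass

/-- A variety is an equational class: the class of all models of some set of identities. -/
def IsVariety (V : IntClass.{u}) : Prop :=
  ∃ E : Set (IntTerm ℕ × IntTerm ℕ), ∀ (A : Type u) [InteriorAlgebra A],
    V A ↔ ∀ e ∈ E, ∀ a : ℕ → A, e.1.eval a = e.2.eval a

/-- `Eq(K)`, the variety generated by the class `K`: the least variety that contains `K`. -/
def generatedVariety (K : IntClass.{u}) : IntClass.{u} := fun A _ =>
  ∀ W : IntClass.{u}, IsVariety W → (∀ (B : Type u) [InteriorAlgebra B], K B → W B) → W A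

theorem generatedVariety_isVariety (K : IntClass.{u}) : IsVariety (generatedVariety K) := by
  refine ⟨{e | ∀ (B : Type u) [InteriorAlgebra B], K B →
    ∀ b : ℕ → B, e.1.eval b = e.2.eval b}, fun A _ => ⟨fun hA e he a => ?_, fun h W hW hK => ?_⟩⟩
  · exact hA (fun B _ => ∀ b : ℕ → B, e.1.eval b = e.2.eval b)
      ⟨{e}, fun B _ => by simp⟩ (fun B _ hB => he B hB) a
  · obtain ⟨E, hE⟩ := hW
    exact (hE A).2 fun e he => h e fun B _ hB => (hE B).1 (hK B hB) e he

/-- `M` is finitely presented in `V`: it belongs to `V` and is presented in `V` by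
finitely many generators and finitely many relations. -/
def IsFinitelyPresented (V : IntClass.{u}) (M : Type u) [InteriorAlgebra M] : Prop :=
  V M ∧ ∃ (n : ℕ) (R : Set (IntTerm (Fin n) × IntTerm (Fin n))) (a : Fin n → M),
    R.Finite ∧ (∀ r ∈ R, r.1.eval a = r.2.eval a) ∧
      ∀ (B : Type u) [InteriorAlgebra B], V B → ∀ b : Fin n → B,
        (∀ r ∈ R, r.1.eval b = r.2.eval b) → ∃! h : InteriorHom M B, ∀ i, h (a i) = b i

/-- `M` is projective in `V`: it belongs to `V` and homomorphisms out of `M` lift along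
surjective homomorphisms of `V`. -/
def IsProjective (V : IntClass.{u}) (M : Type u) [InteriorAlgebra M] : Prop :=
  V M ∧ ∀ (A C : Type u) [InteriorAlgebra A] [InteriorAlgebra C], V A → V C →
    ∀ f : InteriorHom A C, Function.Surjective f → ∀ h : InteriorHom M C,
      ∃ k : InteriorHom M A, ∀ x, f (k x) = h x

/-- The pair `⟨u, M⟩`, where `u : L → M` is a homomorphism, is a unifier in `V` of the algebra
`L`, finitely presented in `V`. -/
structure IsUnifier (V : IntClass.{u}) {L M : Type u} [InteriorAlgebra L] [InteriorAlgebra M]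
    (u : InteriorHom L M) : Prop where
  source_finitelyPresented : IsFinitelyPresented V L
  target_finitelyPresented : IsFinitelyPresented V M
  target_projective : IsProjective V M

end IntClass

/-! ### The free Boolean extension -/

/-- The prime ideals of `L`. -/
abbrev PrimeIdeals (L : Type u) [DistribLattice L] : Type u :=
  {I : Order.Ideal L // I.IsPrime}

/-- The Stone map of `L` into the power set of its prime ideals. -/
def stoneMap (L : Type u) [DistribLattice L] (a : L) : Set (PrimeIdeals L) := {I | a ∉ I.1}

/-- The free Boolean extension `Fr(L)`: the Boolean subalgebra of the power set of the prime
ideals of `L` generated by the image of the Stone map. -/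
abbrev FreeBool (L : Type u) [DistribLattice L] : Type u :=
  ↥(BooleanSubalgebra.closure (Set.range (stoneMap L)))

namespace FreeBool

section Lattice

variable {L : Type u} [DistribLattice L]

theorem stoneMap_bot [BoundedOrder L] : stoneMap L ⊥ = ⊥ := by
  ext I
  simp [stoneMap]

theorem stoneMap_top [BoundedOrder L] : stoneMap L ⊤ = ⊤ := by
  ext I
  simpa [stoneMap] using Order.Ideal.IsProper.top_notMem I.2.toIsProper

theorem stoneMap_sup (a b : L) : stoneMap L (a ⊔ b) = stoneMap L a ⊔ stoneMap L b := by
  ext I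
  simp only [stoneMap, Set.sup_eq_union, Set.mem_union, Set.mem_ofPred_eq, Order.Ideal.sup_mem_iff]
  tauto

theorem stoneMap_inf (a b : L) : stoneMap L (a ⊓ b) = stoneMap L a ⊓ stoneMap L b := by
  ext I
  simp only [stoneMap, Set.inf_eq_inter, Set.mem_inter_iff, Set.mem_ofPred_eq]
  refine ⟨fun h => ⟨fun ha => h (I.1.lower inf_le_left ha),
    fun hb => h (I.1.lower inf_le_right hb)⟩, fun h hab => ?_⟩
  exact (I.2.mem_or_mem hab).elim h.1 h.2

theorem stoneMap_le_iff {a b : L} : stoneMap L a ≤ stoneMap L b ↔ a ≤ b := by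
  refine ⟨fun h => ?_, fun h I ha hb => ha (I.1.lower h hb)⟩
  by_contra hab
  obtain ⟨J, hJ, hbJ, haJ⟩ := DistribLattice.prime_ideal_of_disjoint_filter_ideal
    (F := Order.PFilter.principal a) (I := Order.Ideal.principal b) (by
      rw [Set.disjoint_left]
      intro x hx hx'
      exact hab (le_trans (by simpa using hx) (by simpa using hx')))
  have h1 : (⟨J, hJ⟩ : PrimeIdeals L) ∈ stoneMap L a :=
    Set.disjoint_left.1 haJ (by simp)
  exact h h1 (hbJ (by simp))

variable [BoundedOrder L]

/-- The embedding of `L` into its free Boolean extension. -/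
def of : BoundedLatticeHom L (FreeBool L) where
  toFun a := ⟨stoneMap L a, BooleanSubalgebra.subset_closure ⟨a, rfl⟩⟩
  map_sup' a b := Subtype.ext (stoneMap_sup a b)
  map_inf' a b := Subtype.ext (stoneMap_inf a b)
  map_top' := Subtype.ext stoneMap_top
  map_bot' := Subtype.ext stoneMap_bot

theorem of_le_of_iff {a b : L} : of a ≤ of b ↔ a ≤ b := stoneMap_le_iff

theorem of_injective : Function.Injective (of : L → FreeBool L) := fun _ _ h =>
  le_antisymm (of_le_of_iff.1 h.le) (of_le_of_iff.1 h.ge)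

/-- The element `(-u₁ + v₁) · … · (-uₙ + vₙ)` of the free Boolean extension, for a finite set
`F = {(u₁, v₁), …, (uₙ, vₙ)}` of pairs of elements of `L`. -/
def cnf (F : Finset (L × L)) : FreeBool L := F.inf fun p => (of p.1)ᶜ ⊔ of p.2

theorem exists_cnf (x : FreeBool L) : ∃ F : Finset (L × L), cnf F = x := by
  classical
  suffices H : ∀ y (hy : y ∈ BooleanSubalgebra.closure (Set.range (stoneMap L))),
      ∃ F : Finset (L × L), cnf F = (⟨y, hy⟩ : FreeBool L)ᶜ by
    obtain ⟨F, hF⟩ := H xᶜ.1 xᶜ.2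
    exact ⟨F, by rw [hF, Subtype.coe_eta, compl_compl]⟩
  intro y hy
  have hsub : IsSublattice (Set.range (stoneMap L)) := by
    refine ⟨?_, ?_⟩
    · rintro _ ⟨a, rfl⟩ _ ⟨b, rfl⟩
      exact ⟨a ⊔ b, stoneMap_sup a b⟩
    · rintro _ ⟨a, rfl⟩ _ ⟨b, rfl⟩
      exact ⟨a ⊓ b, stoneMap_inf a b⟩
  induction y, hy using BooleanSubalgebra.closure_sdiff_sup_induction
    (isSublattice := hsub) (bot_mem := ⟨⊥, stoneMap_bot⟩) (top_mem := ⟨⊤, stoneMap_top⟩) with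
  | sdiff x hx y hy =>
    obtain ⟨a, rfl⟩ := hx
    obtain ⟨b, rfl⟩ := hy
    refine ⟨{(a, b)}, ?_⟩
    have : (⟨stoneMap L a \ stoneMap L b, BooleanSubalgebra.sdiff_mem
      (BooleanSubalgebra.subset_closure ⟨a, rfl⟩)
      (BooleanSubalgebra.subset_closure ⟨b, rfl⟩)⟩ : FreeBool L) = of a \ of b := rfl
    rw [this, cnf, Finset.inf_singleton, sdiff_eq, compl_inf, compl_compl]
  | sup x y hx hy ihx ihy =>
    obtain ⟨F, hF⟩ := ihx
    obtain ⟨G, hG⟩ := ihy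
    refine ⟨F ∪ G, ?_⟩
    rw [cnf, Finset.inf_union]
    change cnf F ⊓ cnf G = _
    rw [hF, hG, ← compl_sup]
    rfl

end Lattice

section Heyting

variable {L : Type u} [HeytingAlgebra L]

theorem of_le_cnf_iff (l : L) (F : Finset (L × L)) :
    of l ≤ cnf F ↔ l ≤ F.inf fun p => p.1 ⇨ p.2 := by
  rw [cnf, Finset.le_inf_iff, Finset.le_inf_iff]
  refine forall₂_congr fun p _ => ?_
  rw [le_himp_iff, ← of_le_of_iff (a := l ⊓ p.1), map_inf, sup_comm, ← himp_eq, le_himp_iff]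

/-- The operator `g_L`: if `x = (-u₁ + v₁) · … · (-uₙ + vₙ)` with `uᵢ, vᵢ ∈ L`, then `g_L x` is
`(u₁ ⇒ v₁) · … · (uₙ ⇒ vₙ)`. By `gL_cnf` it does not depend on the representation. -/
noncomputable def gL (x : FreeBool L) : L :=
  (Classical.choose (exists_cnf x)).inf fun p => p.1 ⇨ p.2

theorem le_gL_iff {l : L} {x : FreeBool L} : l ≤ gL x ↔ of l ≤ x := by
  have h := of_le_cnf_iff l (Classical.choose (exists_cnf x))
  rw [Classical.choose_spec (exists_cnf x)] at h
  exact h.symm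

theorem gL_cnf (F : Finset (L × L)) : gL (cnf F) = F.inf fun p => p.1 ⇨ p.2 :=
  eq_of_forall_le_iff fun l => le_gL_iff.trans (of_le_cnf_iff l F)

theorem gL_of (l : L) : gL (of l) = l :=
  eq_of_forall_le_iff fun _ => le_gL_iff.trans of_le_of_iff

/-- The interior algebra `B(L) = ⟨Fr(L), g_L⟩`. -/
noncomputable instance instInteriorAlgebra : InteriorAlgebra (FreeBool L) where
  g x := of (gL x)
  g_top := by rw [← map_top (of : BoundedLatticeHom L (FreeBool L)), gL_of]
  g_inf x y := by
    rw [← map_inf]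
    congr 1
    exact eq_of_forall_le_iff fun l => by
      rw [le_gL_iff, le_inf_iff, le_inf_iff, le_gL_iff, le_gL_iff]
  g_le x := le_gL_iff.1 le_rfl
  g_idem x := by rw [gL_of]

end Heyting

section Map

variable {L M : Type u}

/-- The inverse image of a prime ideal under a homomorphism. -/
def comapIdeal [DistribLattice L] [BoundedOrder L] [DistribLattice M] [BoundedOrder M]
    (h : BoundedLatticeHom L M) (I : PrimeIdeals M) : PrimeIdeals L :=
  ⟨{ carrier := {a | h a ∈ I.1}
     lower' := fun _ _ hab ha => I.1.lower (OrderHomClass.mono h hab) ha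
     nonempty' := ⟨⊥, by simp⟩
     directed' := fun a ha b hb => ⟨a ⊔ b, by
       rw [Set.mem_ofPred_eq, map_sup]
       exact Order.Ideal.sup_mem ha hb, le_sup_left, le_sup_right⟩ }, by
    refine @Order.Ideal.IsPrime.of_mem_or_mem _ _ _
      (Order.Ideal.isProper_of_notMem (p := ⊤) fun ht => ?_) fun {a b} hab => ?_
    · have ht' : h ⊤ ∈ I.1 := ht
      rw [map_top] at ht'
      exact I.2.toIsProper.top_notMem ht'
    · have hab' : h (a ⊓ b) ∈ I.1 := hab
      rw [map_inf] at hab'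
      exact I.2.mem_or_mem hab'⟩

theorem preimage_mem [DistribLattice L] [BoundedOrder L] [DistribLattice M] [BoundedOrder M]
    (h : BoundedLatticeHom L M) (x : FreeBool L) :
    comapIdeal h ⁻¹' x.1 ∈ BooleanSubalgebra.closure (Set.range (stoneMap M)) := by
  obtain ⟨x, hx⟩ := x
  induction hx using BooleanSubalgebra.closure_bot_sup_induction with
  | mem x hx =>
    obtain ⟨a, rfl⟩ := hx
    exact BooleanSubalgebra.subset_closure ⟨h a, rfl⟩
  | bot => exact BooleanSubalgebra.bot_mem
  | sup x hx y hy ihx ihy => exact BooleanSubalgebra.sup_mem ihx ihy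
  | compl x hx ihx => exact BooleanSubalgebra.compl_mem ihx

/-- The Boolean homomorphism `Fr(L) → Fr(M)` that extends `h : L → M`. -/
def mapBool [DistribLattice L] [BoundedOrder L] [DistribLattice M] [BoundedOrder M]
    (h : BoundedLatticeHom L M) : BoundedLatticeHom (FreeBool L) (FreeBool M) where
  toFun x := ⟨comapIdeal h ⁻¹' x.1, preimage_mem h x⟩
  map_sup' _ _ := rfl
  map_inf' _ _ := rfl
  map_top' := rfl
  map_bot' := rfl

theorem mapBool_of [DistribLattice L] [BoundedOrder L] [DistribLattice M] [BoundedOrder M]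
    (h : BoundedLatticeHom L M) (a : L) : mapBool h (of a) = of (h a) := rfl

variable [HeytingAlgebra L] [HeytingAlgebra M]

theorem gL_mapBool (h : HeytingHom L M) (x : FreeBool L) :
    gL (mapBool (h : BoundedLatticeHom L M) x) = h (gL x) := by
  classical
  obtain ⟨F, rfl⟩ := exists_cnf x
  have : mapBool (h : BoundedLatticeHom L M) (cnf F) =
      cnf (F.image fun p => (h p.1, h p.2)) := by
    rw [cnf, cnf, Finset.inf_image, map_finset_inf]
    refine Finset.inf_congr rfl fun p _ => ?_
    rw [Function.comp_apply, map_sup, map_compl', mapBool_of, mapBool_of]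
    rfl
  rw [this, gL_cnf, gL_cnf, Finset.inf_image, map_finset_inf]
  refine Finset.inf_congr rfl fun p _ => ?_
  simp

/-- The homomorphism `B(h) : B(L) → B(M)`; by `map_of` and `map_unique` it is the unique
homomorphism of interior algebras that extends `h`. -/
noncomputable def map (h : HeytingHom L M) : InteriorHom (FreeBool L) (FreeBool M) where
  toBoundedLatticeHom := mapBool (h : BoundedLatticeHom L M)
  map_g' x := (congrArg of (gL_mapBool h x)).symm

theorem map_of (h : HeytingHom L M) (a : L) : map h (of a) = of (h a) := rfl

theorem map_unique (h : HeytingHom L M) (k : InteriorHom (FreeBool L) (FreeBool M))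
    (hk : ∀ a, k (of a) = of (h a)) : k = map h := by
  refine DFunLike.ext _ _ fun x => ?_
  obtain ⟨F, rfl⟩ := exists_cnf x
  change k.toBoundedLatticeHom (cnf F) = (map h).toBoundedLatticeHom (cnf F)
  rw [cnf, map_finset_inf, map_finset_inf]
  refine Finset.inf_congr rfl fun p _ => ?_
  have h1 : k.toBoundedLatticeHom (of p.1) = (map h).toBoundedLatticeHom (of p.1) := hk p.1
  have h2 : k.toBoundedLatticeHom (of p.2) = (map h).toBoundedLatticeHom (of p.2) := hk p.2
  rw [Function.comp_apply, Function.comp_apply, map_sup, map_sup, map_compl', map_compl', h1, h2]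

end Map

end FreeBool

/-! ### The operator `ρ*` -/

/-- The class `B[V]` of the algebras `B(L)`, `L ∈ V`, up to isomorphism. -/
def imageB (V : HeytClass.{u}) : IntClass.{u} := fun A _ =>
  ∃ (L : Type u) (_ : HeytingAlgebra L), V L ∧
    ∃ f : InteriorHom A (FreeBool L), Function.Bijective f

/-- `ρ*(V) = Eq(B[V])`. -/
def rhoStar (V : HeytClass.{u}) : IntClass.{u} := IntClass.generatedVariety (imageB V)

/-!
The functor `𝓑` from Heyting algebras to interior algebras is left adjoint to the functor `𝓞` of
open elements. Since `𝓞` preserves surjections, `𝓑` preserves projectivity. By the Gödel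
translation, identities and relations in `𝓞 A` are identities and relations in `A`. So a finite
presentation of `L` translates into one of `𝓑 L`, once the generators are also required to be open,
and the interior algebras `A` with `𝓞 A ∈ V` form a variety. This variety contains every `𝓑 L` with
`L ∈ V`, because `𝓞 (𝓑 L) ≅ L`, and therefore contains `ρ*(V)`.
-/

namespace InteriorHom

variable {A B C : Type*} [InteriorAlgebra A] [InteriorAlgebra B] [InteriorAlgebra C]

instance instBoundedLatticeHomClass : BoundedLatticeHomClass (InteriorHom A B) A B where
  map_sup f := f.map_sup'
  map_inf f := f.map_inf'
  map_top f := f.map_top'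
  map_bot f := f.map_bot'

theorem map_g (f : InteriorHom A B) (a : A) :
    f (InteriorAlgebra.g a) = InteriorAlgebra.g (f a) :=
  f.map_g' a

/-- The composite of two homomorphisms of interior algebras. -/
def comp (f : InteriorHom B C) (f' : InteriorHom A B) : InteriorHom A C where
  toBoundedLatticeHom := f.toBoundedLatticeHom.comp f'.toBoundedLatticeHom
  map_g' a := (congrArg f (f'.map_g a)).trans (f.map_g (f' a))

end InteriorHom

namespace InteriorAlgebra

variable {A : Type*} [InteriorAlgebra A]

/-- The interior operator, as a homomorphism of meet-semilattices with top. -/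
def gHom (A : Type*) [InteriorAlgebra A] : InfTopHom A A where
  toFun := g
  map_inf' := g_inf
  map_top' := g_top

theorem g_mono : Monotone (g : A → A) :=
  OrderHomClass.mono (gHom A)

theorem g_bot : g (⊥ : A) = ⊥ :=
  le_bot_iff.1 (g_le ⊥)

theorem le_g_iff {a b : A} (ha : g a = a) : a ≤ g b ↔ a ≤ b :=
  ⟨fun h => h.trans (g_le b), fun h => ha.ge.trans (g_mono h)⟩

theorem g_inf_of_open {a b : A} (ha : g a = a) (hb : g b = b) : g (a ⊓ b) = a ⊓ b := by
  rw [g_inf, ha, hb]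

theorem g_sup_of_open {a b : A} (ha : g a = a) (hb : g b = b) : g (a ⊔ b) = a ⊔ b :=
  (g_le _).antisymm (sup_le ((le_g_iff ha).2 le_sup_left) ((le_g_iff hb).2 le_sup_right))

end InteriorAlgebra

/-- The algebra `𝓞 A` of open elements of an interior algebra `A`, i.e. of fixed points of `g`. -/
abbrev OpenElements (A : Type u) [InteriorAlgebra A] : Type u :=
  {a : A // InteriorAlgebra.g a = a}

namespace OpenElements

open InteriorAlgebra

variable {A B : Type*} [InteriorAlgebra A] [InteriorAlgebra B]

instance instLattice : Lattice (OpenElements A) :=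
  Subtype.lattice (fun _ _ => g_sup_of_open) (fun _ _ => g_inf_of_open)

instance instHeytingAlgebra : HeytingAlgebra (OpenElements A) where
  top := ⟨⊤, g_top⟩
  le_top a := le_top (a := (a : A))
  bot := ⟨⊥, g_bot⟩
  bot_le a := bot_le (a := (a : A))
  himp a b := ⟨g (a ⇨ b), g_idem _⟩
  le_himp_iff a _ _ := (le_g_iff a.2).trans le_himp_iff
  compl a := ⟨g (a : A)ᶜ, g_idem _⟩
  himp_bot a := Subtype.ext (congrArg g (himp_bot (a : A)))

theorem coe_himp (a b : OpenElements A) : ((a ⇨ b : OpenElements A) : A) = g ((a : A) ⇨ b) :=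
  rfl

/-- The inclusion of the lattice of open elements. -/
def incl (A : Type*) [InteriorAlgebra A] : BoundedLatticeHom (OpenElements A) A where
  toFun := Subtype.val
  map_sup' _ _ := rfl
  map_inf' _ _ := rfl
  map_top' := rfl
  map_bot' := rfl

/-- The interior of an element, as an open element. -/
def interior (a : A) : OpenElements A :=
  ⟨g a, g_idem a⟩

theorem interior_coe (a : OpenElements A) : interior (a : A) = a :=
  Subtype.ext a.2

/-- The restriction `𝓞 f : 𝓞 A → 𝓞 B` of a homomorphism `f : A → B` to open elements. -/
def map (f : InteriorHom A B) : HeytingHom (OpenElements A) (OpenElements B) where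
  toFun a := ⟨f a, by rw [← f.map_g, a.2]⟩
  map_sup' a b := Subtype.ext (map_sup f (a : A) b)
  map_inf' a b := Subtype.ext (map_inf f (a : A) b)
  map_bot' := Subtype.ext (map_bot f)
  map_himp' a b := Subtype.ext ((f.map_g _).trans (congrArg g (map_himp f (a : A) b)))

theorem map_injective {f : InteriorHom A B} (hf : Function.Injective f) :
    Function.Injective (map f) := fun _ _ h =>
  Subtype.ext (hf (congrArg Subtype.val h))

theorem map_surjective {f : InteriorHom A B} (hf : Function.Surjective f) :
    Function.Surjective (map f) := fun b => by
  obtain ⟨a, ha⟩ := hf b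
  refine ⟨interior a, Subtype.ext ?_⟩
  calc f (g a) = g (f a) := f.map_g a
    _ = b := by rw [ha, b.2]

end OpenElements

namespace HeytTerm

variable {X : Type} {A B : Type*}

theorem map_eval [HeytingAlgebra A] [HeytingAlgebra B] (f : HeytingHom A B) (a : X → A)
    (t : HeytTerm X) : f (t.eval a) = t.eval (f ∘ a) := by
  induction t with
  | var x => rfl
  | bot => exact map_bot f
  | top => exact map_top f
  | inf s t hs ht => simp only [eval, map_inf, hs, ht]
  | sup s t hs ht => simp only [eval, map_sup, hs, ht]
  | imp s t hs ht => simp only [eval, map_himp, hs, ht]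

/-- The Gödel translation of Heyting terms. -/
def translate : HeytTerm X → IntTerm X
  | var x => .g (.var x)
  | bot => .bot
  | top => .top
  | inf s t => .inf s.translate t.translate
  | sup s t => .sup s.translate t.translate
  | imp s t => .g (.sup t.translate (.compl s.translate))

variable [InteriorAlgebra A]

theorem eval_translate (a : X → A) (t : HeytTerm X) :
    t.translate.eval a = t.eval fun x => OpenElements.interior (a x) := by
  induction t with
  | var x => rfl
  | bot => rfl
  | top => rfl
  | inf s t hs ht => exact congrArg₂ (· ⊓ ·) hs ht
  | sup s t hs ht => exact congrArg₂ (· ⊔ ·) hs ht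
  | imp s t hs ht =>
    simp only [translate, IntTerm.eval, eval, OpenElements.coe_himp, himp_eq, hs, ht]

theorem eval_translate_eq_iff {s t : HeytTerm X} {a : X → OpenElements A} :
    s.translate.eval (Subtype.val ∘ a) = t.translate.eval (Subtype.val ∘ a) ↔
      s.eval a = t.eval a := by
  simp only [eval_translate, Function.comp_apply, OpenElements.interior_coe, Subtype.ext_iff]

theorem forall_eval_translate_eq_iff {s t : HeytTerm X} :
    (∀ a : X → A, s.translate.eval a = t.translate.eval a) ↔
      ∀ a : X → OpenElements A, s.eval a = t.eval a :=
  ⟨fun h _ => eval_translate_eq_iff.1 (h _), fun h a => by rw [eval_translate, eval_translate, h]⟩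

/-- The relations between generators of an interior algebra which say that these generators are
open and satisfy the relations `R` in the Heyting algebra of open elements. -/
def translateRelations (R : Set (HeytTerm X × HeytTerm X)) : Set (IntTerm X × IntTerm X) :=
  Prod.map translate translate '' R ∪ Set.range fun x => (.g (.var x), .var x)

theorem finite_translateRelations [Finite X] {R : Set (HeytTerm X × HeytTerm X)} (hR : R.Finite) :
    (translateRelations R).Finite :=
  (hR.image _).union (Set.finite_range _)

theorem forall_mem_translateRelations_iff {R : Set (HeytTerm X × HeytTerm X)} {b : X → A} :
    (∀ r ∈ translateRelations R, r.1.eval b = r.2.eval b) ↔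
      ∃ a : X → OpenElements A, Subtype.val ∘ a = b ∧ ∀ r ∈ R, r.1.eval a = r.2.eval a := by
  constructor
  · intro h
    have hb (x : X) : InteriorAlgebra.g (b x) = b x := h _ (.inr ⟨x, rfl⟩)
    exact ⟨fun x => ⟨b x, hb x⟩, rfl, fun r hr =>
      eval_translate_eq_iff.1 (h _ (.inl ⟨r, hr, rfl⟩))⟩
  · rintro ⟨a, rfl, ha⟩ _ (⟨r, hr, rfl⟩ | ⟨x, rfl⟩)
    · exact eval_translate_eq_iff.2 (ha r hr)
    · exact (a x).2

end HeytTerm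

namespace FreeBool

section Boolean

theorem cnf_eq_inf_himp {L : Type*} [DistribLattice L] [BoundedOrder L] (F : Finset (L × L)) :
    cnf F = F.inf fun p => of p.1 ⇨ of p.2 :=
  Finset.inf_congr rfl fun _ _ => by rw [himp_eq, sup_comm]

theorem map_cnf {L A : Type*} [DistribLattice L] [BoundedOrder L] [BooleanAlgebra A]
    (f : BoundedLatticeHom (FreeBool L) A) (F : Finset (L × L)) :
    f (cnf F) = F.inf fun p => f (of p.1) ⇨ f (of p.2) := by
  rw [cnf_eq_inf_himp, map_finset_inf]
  exact Finset.inf_congr rfl fun p _ => map_himp f _ _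

theorem of_surjective {A : Type*} [BooleanAlgebra A] :
    Function.Surjective (of : A → FreeBool A) := fun x => by
  obtain ⟨F, rfl⟩ := exists_cnf x
  refine ⟨F.inf fun p => p.1 ⇨ p.2, ?_⟩
  rw [cnf_eq_inf_himp, map_finset_inf]
  exact Finset.inf_congr rfl fun p _ => map_himp of _ _

/-- A Boolean algebra is its own free Boolean extension. -/
noncomputable def orderIsoOfBoolean (A : Type*) [BooleanAlgebra A] : A ≃o FreeBool A :=
  RelIso.ofSurjective (OrderEmbedding.ofMapLEIff of fun _ _ => of_le_of_iff) of_surjective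

variable {L A : Type u} [DistribLattice L] [BoundedOrder L] [BooleanAlgebra A]

/-- The extension to `Fr(L)` of a lattice homomorphism from `L` to a Boolean algebra `A`. -/
noncomputable def liftBool (h : BoundedLatticeHom L A) : BoundedLatticeHom (FreeBool L) A :=
  ((orderIsoOfBoolean A).symm : BoundedLatticeHom (FreeBool A) A).comp (mapBool h)

theorem liftBool_of (h : BoundedLatticeHom L A) (l : L) : liftBool h (of l) = h l :=
  (orderIsoOfBoolean A).symm_apply_apply (h l)

end Boolean

theorem interiorHom_ext {L A : Type*} [HeytingAlgebra L] [InteriorAlgebra A]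
    {k k' : InteriorHom (FreeBool L) A} (h : ∀ l, k (of l) = k' (of l)) : k = k' := by
  refine DFunLike.ext _ _ fun x => ?_
  obtain ⟨F, rfl⟩ := exists_cnf x
  calc k (cnf F) = F.inf fun p => k (of p.1) ⇨ k (of p.2) := map_cnf k.toBoundedLatticeHom F
    _ = F.inf fun p => k' (of p.1) ⇨ k' (of p.2) := by simp only [h]
    _ = k' (cnf F) := (map_cnf k'.toBoundedLatticeHom F).symm

/-- The isomorphism `L ≅ 𝓞 (𝓑 L)`, which is the unit of the adjunction between `𝓑` and `𝓞`. -/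
noncomputable def openElementsOrderIso (L : Type*) [HeytingAlgebra L] :
    L ≃o OpenElements (FreeBool L) where
  toFun l := ⟨of l, congrArg of (gL_of l)⟩
  invFun x := gL x.1
  left_inv := gL_of
  right_inv x := Subtype.ext x.2
  map_rel_iff' := of_le_of_iff

variable {L A : Type u} [HeytingAlgebra L] [InteriorAlgebra A]

theorem liftBool_g (h : HeytingHom L (OpenElements A)) (x : FreeBool L) :
    liftBool ((OpenElements.incl A).comp h) (InteriorAlgebra.g x) =
      InteriorAlgebra.g (liftBool ((OpenElements.incl A).comp h) x) := by
  obtain ⟨F, rfl⟩ := exists_cnf x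
  calc liftBool ((OpenElements.incl A).comp h) (of (gL (cnf F)))
      = OpenElements.incl A (h (F.inf fun p => p.1 ⇨ p.2)) := by rw [liftBool_of, gL_cnf]; rfl
    _ = F.inf fun p => InteriorAlgebra.g ((h p.1 : A) ⇨ h p.2) := by
      rw [map_finset_inf, map_finset_inf]
      exact Finset.inf_congr rfl fun p _ => congrArg Subtype.val (map_himp h p.1 p.2)
    _ = InteriorAlgebra.g (F.inf fun p => (h p.1 : A) ⇨ h p.2) :=
      (map_finset_inf (InteriorAlgebra.gHom A) F _).symm
    _ = InteriorAlgebra.g (liftBool ((OpenElements.incl A).comp h) (cnf F)) := by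
      simp only [map_cnf, liftBool_of]
      rfl

/-- The adjunction between `𝓑` and `𝓞`: homomorphisms `L → 𝓞 A` correspond to homomorphisms
`𝓑 L → A`. -/
noncomputable def lift : HeytingHom L (OpenElements A) ≃ InteriorHom (FreeBool L) A where
  toFun h := ⟨liftBool ((OpenElements.incl A).comp h), liftBool_g h⟩
  invFun k := (OpenElements.map k).comp (openElementsOrderIso L)
  left_inv _ := DFunLike.ext _ _ fun l => Subtype.ext (liftBool_of _ l)
  right_inv _ := interiorHom_ext (liftBool_of _)

theorem lift_of (h : HeytingHom L (OpenElements A)) (l : L) : lift h (of l) = h l :=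
  liftBool_of _ l

end FreeBool

theorem rhoStar_freeBool {V : HeytClass.{u}} {L : Type u} [HeytingAlgebra L] (hL : V L) :
    rhoStar V (FreeBool L) := fun _ _ hW =>
  hW _ ⟨L, _, hL, ⟨BoundedLatticeHom.id _, fun _ => rfl⟩, Function.bijective_id⟩

namespace HeytClass

variable {V : HeytClass.{u}}

theorem IsVariety.of_injective (hV : IsVariety V) {A B : Type u} [HeytingAlgebra A]
    [HeytingAlgebra B] {f : HeytingHom A B} (hf : Function.Injective f) (hB : V B) : V A := by
  obtain ⟨E, hE⟩ := hV
  refine (hE A).2 fun e he a => hf ?_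
  rw [HeytTerm.map_eval, HeytTerm.map_eval, (hE B).1 hB e he]

theorem IsVariety.openElements (hV : IsVariety V) :
    IntClass.IsVariety fun A _ => V (OpenElements A) := by
  obtain ⟨E, hE⟩ := hV
  refine ⟨Prod.map HeytTerm.translate HeytTerm.translate '' E, fun A _ => (hE _).trans ?_⟩
  rw [Set.forall_mem_image]
  exact forall₂_congr fun e _ => HeytTerm.forall_eval_translate_eq_iff.symm

theorem IsVariety.openElements_of_rhoStar (hV : IsVariety V) {A : Type u} [InteriorAlgebra A]
    (hA : rhoStar V A) : V (OpenElements A) := by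
  refine hA _ hV.openElements fun B _ ⟨L, _, hL, f, hf⟩ => ?_
  let e : HeytingHom (OpenElements (FreeBool L)) L := (FreeBool.openElementsOrderIso L).symm
  have he : Function.Injective e := (FreeBool.openElementsOrderIso L).symm.injective
  exact hV.of_injective (f := e.comp (OpenElements.map f))
    (he.comp (OpenElements.map_injective hf.injective)) hL

variable {W : IntClass.{u}} {M : Type u} [HeytingAlgebra M]

theorem IsFinitelyPresented.freeBool (hM : IsFinitelyPresented V M) (hWM : W (FreeBool M))
    (hWV : ∀ (A : Type u) [InteriorAlgebra A], W A → V (OpenElements A)) :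
    IntClass.IsFinitelyPresented W (FreeBool M) := by
  obtain ⟨-, n, R, a, hR, ha, huniv⟩ := hM
  let unit : HeytingHom M (OpenElements (FreeBool M)) := FreeBool.openElementsOrderIso M
  have hunit : ∀ r ∈ R, r.1.eval (unit ∘ a) = r.2.eval (unit ∘ a) := fun r hr => by
    rw [← HeytTerm.map_eval, ← HeytTerm.map_eval, ha r hr]
  refine ⟨hWM, n, HeytTerm.translateRelations R, FreeBool.of ∘ a,
    HeytTerm.finite_translateRelations hR,
    HeytTerm.forall_mem_translateRelations_iff.2 ⟨_, rfl, hunit⟩, fun B _ hB b hb => ?_⟩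
  obtain ⟨c, rfl, hc⟩ := HeytTerm.forall_mem_translateRelations_iff.1 hb
  refine (FreeBool.lift.existsUnique_congr fun h => forall_congr' fun i => ?_).1
    (huniv _ (hWV B hB) c hc)
  rw [Function.comp_apply, FreeBool.lift_of, Subtype.ext_iff, Function.comp_apply]

theorem IsProjective.freeBool (hM : IsProjective V M) (hWM : W (FreeBool M))
    (hWV : ∀ (A : Type u) [InteriorAlgebra A], W A → V (OpenElements A)) :
    IntClass.IsProjective W (FreeBool M) := by
  refine ⟨hWM, fun A C _ _ hA hC f hf h => ?_⟩
  obtain ⟨k, hk⟩ := hM.2 _ _ (hWV A hA) (hWV C hC) (OpenElements.map f)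
    (OpenElements.map_surjective hf) (FreeBool.lift.symm h)
  have hfk : f.comp (FreeBool.lift k) = h := FreeBool.interiorHom_ext fun l =>
    calc f (FreeBool.lift k (FreeBool.of l)) = f (k l) := by rw [FreeBool.lift_of]
      _ = h (FreeBool.of l) := congrArg Subtype.val (hk l)
  exact ⟨FreeBool.lift k, DFunLike.congr_fun hfk⟩

end HeytClass

theorem mainTheorem6 (V : HeytClass.{u}) (hV : HeytClass.IsVariety V) :
    (∀ (L M : Type u) [HeytingAlgebra L] [HeytingAlgebra M] (h : HeytingHom L M),
      HeytClass.IsUnifier V h → IntClass.IsUnifier (rhoStar V) (FreeBool.map h)) ∧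
    (∀ (M : Type u) [HeytingAlgebra M],
      HeytClass.IsFinitelyPresented V M → HeytClass.IsProjective V M →
        IntClass.IsFinitelyPresented (rhoStar V) (FreeBool M) ∧
          IntClass.IsProjective (rhoStar V) (FreeBool M)) := by
  have finitelyPresented (M : Type u) [HeytingAlgebra M] (hM : HeytClass.IsFinitelyPresented V M) :
      IntClass.IsFinitelyPresented (rhoStar V) (FreeBool M) :=
    hM.freeBool (rhoStar_freeBool hM.1) fun _ _ => hV.openElements_of_rhoStar
  have projective (M : Type u) [HeytingAlgebra M] (hM : HeytClass.IsProjective V M) :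
      IntClass.IsProjective (rhoStar V) (FreeBool M) :=
    hM.freeBool (rhoStar_freeBool hM.1) fun _ _ => hV.openElements_of_rhoStar
  exact ⟨fun L M _ _ _ hu => ⟨finitelyPresented L hu.source_finitelyPresented,
      finitelyPresented M hu.target_finitelyPresented, projective M hu.target_projective⟩,
    fun M _ hfp hpr => ⟨finitelyPresented M hfp, projective M hpr⟩⟩
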